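/- Let $d,d'\ge 1$ be integers, $D=d+d'$, $0<p<\infty$, $0<q\le\infty$, $d/p<s<\infty$. Let $\Psi^0,\Psi^1:\mathbb R\to\mathbb R$ be the scaling function and the mother wavelet of a compactly supported orthonormal multiresolution analysis of $L^2(\mathbb R)$ that is $R$-regular with $R\ge\lfloor s+1\rfloor$: $\Psi^0,\Psi^1\in C^R$, and $\int x^n\Psi^1(x)\,dx=0$ for $0\le n\le R$. For $m\in\{d,D\}$ let $I_m$ be the set of $\lambda=(j,\mathbf k,\mathbf l)$ with $j\ge1$, $\mathbf k\in\{0,\dots,2^j-1\}^m$, $\mathbf l\in\{0,1\}^m\setminus\{0\}$, and put $\Psi_\lambda(x)=\prod_{i=1}^m\Psi^{l_i}(2^jx_i-k_i)$, $x\in\mathbb R^m$. For $c=(c_\lambda)_{\lambda\in I_D}$ real let $$\|c\|=\Bigl(\sum_{j\ge1}\Bigl(2^{(sp-D)j}\sum_{\mathbf k,\mathbf l}|c_{(j,\mathbf k,\mathbf l)}|^p\Bigr)^{q/p}\Bigr)^{1/q}$$ (supremum over $j$ of the $1/p$-th powers if $q=\infty$). The Besov space $B^s_{p,q}([0,1]^D)$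 consists of the $f=\sum_{\lambda\in I_D}c_\lambda\Psi_\lambda$ with $\|f\|:=\|c\|<\infty$, where $f$ is identified with the family $c$ of its wavelet coefficients; it carries the topology of this (quasi-)norm. For $a\in[0,1]^{d'}$ the trace is $f_a(x)=f(x,a)=\sum_{j\ge 1}\sum_{\mathbf k,\mathbf l}c_{(j,\mathbf k,\mathbf l)}\Psi_{(j,\mathbf k,\mathbf l)}(x,a)$, $x\in\mathbb R^d$, which is defined for Lebesgue-almost every $a$, and for $\lambda=(j,\mathbf k,\mathbf l)\in I_d$ its wavelet coefficients are $c_\lambda(a)=2^{jd}\int_{\mathbb R^d}f_a(x)\Psi_\lambda(x)\,dx$. For $\alpha>1$ let $\mathcal X^\alpha$ be the set of $x\in[0,1]^d$ such that for infinitely many $j$ there is $\mathbf k\in\{0,\dots,2^j-1\}^d$ with $\|x-\mathbf k2^{-j}\|_\infty\le2^{-\alpha j}$. Let $\gamma>s-\frac dp+\frac d{\alpha p}$, $N\in\mathbb N$, let $|\cdot|$ be a norm on $\mathbb R^d$, and let $$\mathcal A_{\gamma,N}(f)=\bigl\{a\in[0,1]^{d'}:\ \exists x\in\mathcal X^\alpha\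 \forall\lambda=(j,\mathbf k,\mathbf l)\in I_d,\ |c_\lambda(a)|\le N2^{-\gamma j}(1+|2^jx-\mathbf k|)^\gamma\bigr\},$$ $$\mathcal O_{\gamma,N}=\bigl\{f\in B^s_{p,q}([0,1]^D):\ \mathcal L_{d'}(\mathcal A_{\gamma,N}(f))>0\bigr\}.$$ Then $\mathcal O_{\gamma,N}$ is universally measurable in $B^s_{p,q}([0,1]^D)$, that is, measurable for the completion of every $\sigma$-finite Borel measure on $B^s_{p,q}([0,1]^D)$. If moreover $s>D/p$, the same holds when $B^s_{p,q}([0,1]^D)$ is taken as a space of functions, namely of those $f:\mathbb R^D\to\mathbb R$ whose wavelet coefficients $c_\lambda=2^{jD}\int_{\mathbb R^D} f\Psi_\lambda$, $\lambda=(j,\mathbf k,\mathbf l)\in I_D$, satisfy $\|c\|<\infty$ and $f(y)=\sum_{j\ge 1}\sum_{\mathbf k,\mathbf l} c_{(j,\mathbf k,\mathbf l)}\Psi_{(j,\mathbf k,\mathbf l)}(y)$ for every $y\in\mathbb R^D$, with the topology of $\|\cdot\|$ and with $f_a(x)=f(x,a)$. -/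

import Mathlib

noncomputable section

/-- `Ψ 0` is the scaling function and `Ψ 1` the mother wavelet of a compactly supported,
`R`-regular multiresolution analysis of `L²(ℝ)`. The functions `x ↦ Ψ 1 (2 ^ j x - k)` are kept in
the `L^∞` normalisation, so their squared `L²` norm is `2 ^ (-j)`. -/
structure IsRegularWavelet (R : ℕ) (Ψ : Fin 2 → ℝ → ℝ) : Prop where
  contDiff : ∀ l, ContDiff ℝ R (Ψ l)
  compactSupport : ∀ l, HasCompactSupport (Ψ l)
  vanishing_moments : ∀ n : ℕ, n ≤ R → ∫ x : ℝ, x ^ n * Ψ 1 x = 0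
  scaling_orthonormal : ∀ k m : ℤ,
    ∫ x : ℝ, Ψ 0 (x - k) * Ψ 0 (x - m) = if k = m then 1 else 0
  scaling_orthogonal_wavelet : ∀ k m : ℤ, ∫ x : ℝ, Ψ 0 (x - k) * Ψ 1 (x - m) = 0
  wavelet_orthogonal : ∀ i j k m : ℤ,
    ∫ x : ℝ, Ψ 1 ((2 : ℝ) ^ i * x - k) * Ψ 1 ((2 : ℝ) ^ j * x - m) =
      if i = j ∧ k = m then (2 : ℝ) ^ (-j) else 0
  wavelet_complete : ∀ f : ℝ → ℝ, MeasureTheory.MemLp f 2 MeasureTheory.volume →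
    (∀ j k : ℤ, ∫ x : ℝ, f x * Ψ 1 ((2 : ℝ) ^ j * x - k) = 0) →
      f =ᵐ[MeasureTheory.volume] 0
  refinement : ∃ h : Fin 2 → ℤ →₀ ℝ, ∀ l x,
    Ψ l x = (h l).sum fun k c => c * Ψ 0 (2 * x - k)

/-- The indices `(j, k, l)` with `j ≥ 1`, `k ∈ {0, …, 2 ^ j - 1} ^ ι` and `l ∈ {0, 1} ^ ι`, `l ≠ 0`.
-/
abbrev WaveletIndex (ι : Type) : Type :=
  Σ j : ℕ+, (ι → Fin (2 ^ (j : ℕ))) × {l : ι → Fin 2 // l ≠ 0}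

/-- The tensorized wavelet `x ↦ ∏ i, Ψ^{l i} (2 ^ j x i - k i)`. -/
def tensorWavelet {ι : Type} [Fintype ι] (Ψ : Fin 2 → ℝ → ℝ) (lam : WaveletIndex ι)
    (x : ι → ℝ) : ℝ :=
  ∏ i, Ψ (lam.2.2.1 i) (2 ^ (lam.1 : ℕ) * x i - ((lam.2.1 i : ℕ) : ℝ))

/-- The wavelet coefficient `2 ^ (j d) ∫ f Ψ_λ`, with `d` the number of variables. -/
def waveletCoeff {ι : Type} [Fintype ι] (Ψ : Fin 2 → ℝ → ℝ) (f : (ι → ℝ) → ℝ)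
    (lam : WaveletIndex ι) : ℝ :=
  2 ^ ((lam.1 : ℕ) * Fintype.card ι) * ∫ x, f x * tensorWavelet Ψ lam x

/-- The part at scale `j` of the wavelet series with coefficients `c`. -/
def waveletBlock {ι : Type} [Fintype ι] [DecidableEq ι] (Ψ : Fin 2 → ℝ → ℝ)
    (c : WaveletIndex ι → ℝ) (j : ℕ+) (x : ι → ℝ) : ℝ :=
  ∑ kl : (ι → Fin (2 ^ (j : ℕ))) × {l : ι → Fin 2 // l ≠ 0},
    c ⟨j, kl⟩ * tensorWavelet Ψ ⟨j, kl⟩ x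

/-- The sum of the wavelet series with coefficients `c`. -/
def waveletSeries {ι : Type} [Fintype ι] [DecidableEq ι] (Ψ : Fin 2 → ℝ → ℝ)
    (c : WaveletIndex ι → ℝ) (x : ι → ℝ) : ℝ :=
  ∑' j : ℕ+, waveletBlock Ψ c j x

/-- `2 ^ ((s p - D) j) ∑_{k, l} |c_{j,k,l}| ^ p`, with `D` the number of variables. -/
def besovLevel {ι : Type} [Fintype ι] [DecidableEq ι] (s p : ℝ)
    (c : WaveletIndex ι → ℝ) (j : ℕ+) : ℝ :=
  2 ^ ((s * p - Fintype.card ι) * ((j : ℕ) : ℝ)) *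
    ∑ kl : (ι → Fin (2 ^ (j : ℕ))) × {l : ι → Fin 2 // l ≠ 0}, |c ⟨j, kl⟩| ^ p

/-- The Besov `(s, p, q)` (quasi-)norm of the function with wavelet coefficients `c`. -/
def besovNorm {ι : Type} [Fintype ι] [DecidableEq ι] (s p : ℝ) (q : ENNReal)
    (c : WaveletIndex ι → ℝ) : ENNReal :=
  if q = ⊤ then ⨆ j : ℕ+, ENNReal.ofReal (besovLevel s p c j) ^ (1 / p)
  else (∑' j : ℕ+, ENNReal.ofReal (besovLevel s p c j) ^ (q.toReal / p)) ^ (1 / q.toReal)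

/-- The Besov space on the unit cube: the generalised functions `∑ c_λ Ψ_λ` of finite (quasi-)norm,
each recorded by its family of wavelet coefficients. -/
def BesovSpace (ι : Type) [Fintype ι] [DecidableEq ι] (s p : ℝ) (q : ENNReal) : Type :=
  {c : WaveletIndex ι → ℝ // besovNorm s p q c < ⊤}

/-- The topology of the (quasi-)norm. -/
instance {ι : Type} [Fintype ι] [DecidableEq ι] (s p : ℝ) (q : ENNReal) :
    TopologicalSpace (BesovSpace ι s p q) where
  IsOpen U := ∀ c ∈ U, ∃ ε : ENNReal, 0 < ε ∧
    ∀ c' : BesovSpace ι s p q, besovNorm s p q (c'.1 - c.1) < ε → c' ∈ U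
  isOpen_univ := fun _ _ => ⟨1, one_pos, fun _ _ => trivial⟩
  isOpen_inter := by
    rintro U V hU hV c ⟨hcU, hcV⟩
    obtain ⟨ε, hε, h⟩ := hU c hcU
    obtain ⟨δ, hδ, h'⟩ := hV c hcV
    exact ⟨min ε δ, lt_min hε hδ, fun c' hc' =>
      ⟨h c' (hc'.trans_le (min_le_left _ _)), h' c' (hc'.trans_le (min_le_right _ _))⟩⟩
  isOpen_sUnion := by
    rintro S hS c ⟨U, hU, hc⟩
    obtain ⟨ε, hε, h⟩ := hS U hU c hc
    exact ⟨ε, hε, fun c' hc' => ⟨U, hU, h c' hc'⟩⟩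

/-- The Besov space as a space of functions: those functions whose wavelet coefficients
`2 ^ (j D) ∫ f Ψ_λ` have finite (quasi-)norm and which are everywhere the sum of their wavelet
series. This is the Besov space in the range `s > D / p`, where the series of every element
converges uniformly. -/
def BesovFunction {ι : Type} [Fintype ι] [DecidableEq ι] (Ψ : Fin 2 → ℝ → ℝ) (s p : ℝ)
    (q : ENNReal) : Type :=
  {f : (ι → ℝ) → ℝ // besovNorm s p q (waveletCoeff Ψ f) < ⊤ ∧
    ∀ x, HasSum (fun j : ℕ+ => waveletBlock Ψ (waveletCoeff Ψ f) j x) (f x)}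

/-- The topology of the (quasi-)norm. -/
instance {ι : Type} [Fintype ι] [DecidableEq ι] (Ψ : Fin 2 → ℝ → ℝ) (s p : ℝ) (q : ENNReal) :
    TopologicalSpace (BesovFunction (ι := ι) Ψ s p q) :=
  TopologicalSpace.induced
    (fun f => (⟨waveletCoeff Ψ f.1, f.2.1⟩ : BesovSpace ι s p q)) inferInstance

/-- The points of `[0, 1] ^ d` that lie, for infinitely many `j`, in a closed `ℓ^∞` ball of radius
`2 ^ (-α j)` around some `k 2 ^ (-j)`, `k ∈ {0, …, 2 ^ j - 1} ^ d`. -/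
def dyadicApprox (d : ℕ) (α : ℝ) : Set (Fin d → ℝ) :=
  {x | x ∈ Set.Icc 0 1 ∧ ∃ᶠ j : ℕ in Filter.atTop, ∃ k : Fin d → Fin (2 ^ j),
    x ∈ Metric.closedBall (fun i => ((k i : ℕ) : ℝ) / 2 ^ j) (2 ^ (-(α * j)))}

/-- The trace `f_a : x ↦ f (x, a)`. -/
def trace {d d' : ℕ} (f : (Fin d ⊕ Fin d' → ℝ) → ℝ) (a : Fin d' → ℝ) (x : Fin d → ℝ) : ℝ :=
  f (Sum.elim x a)

/-- The set `𝒜_{γ,N}(f)` of parameters `a ∈ [0, 1] ^ d'`; `ν` is the norm `|·|` on `ℝ ^ d`. -/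
def parameterSet {d d' : ℕ} (Ψ : Fin 2 → ℝ → ℝ) (ν : Seminorm ℝ (Fin d → ℝ)) (α γ : ℝ) (N : ℕ)
    (f : (Fin d ⊕ Fin d' → ℝ) → ℝ) : Set (Fin d' → ℝ) :=
  {a | a ∈ Set.Icc 0 1 ∧ ∃ x ∈ dyadicApprox d α, ∀ lam : WaveletIndex (Fin d),
    |waveletCoeff Ψ (trace f a) lam| ≤ N * 2 ^ (-(γ * ((lam.1 : ℕ) : ℝ))) *
      (1 + ν (fun i => 2 ^ (lam.1 : ℕ) * x i - ((lam.2.1 i : ℕ) : ℝ))) ^ γ}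

/-- The ancillary set `𝒪_{γ,N}` in the Besov space. For `s > d / p` the series that defines the
trace `f_a` converges, uniformly in `x`, for almost every `a`; the other `a` do not matter. -/
def ancillarySet {d d' : ℕ} (Ψ : Fin 2 → ℝ → ℝ) (ν : Seminorm ℝ (Fin d → ℝ)) (s p : ℝ)
    (q : ENNReal) (α γ : ℝ) (N : ℕ) : Set (BesovSpace (Fin d ⊕ Fin d') s p q) :=
  {c | 0 < MeasureTheory.volume (parameterSet Ψ ν α γ N (waveletSeries Ψ c.1))}

/-- The ancillary set `𝒪_{γ,N}` in the Besov space of functions. -/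
def ancillaryFunctionSet {d d' : ℕ} (Ψ : Fin 2 → ℝ → ℝ) (ν : Seminorm ℝ (Fin d → ℝ)) (s p : ℝ)
    (q : ENNReal) (α γ : ℝ) (N : ℕ) :
    Set (BesovFunction (ι := Fin d ⊕ Fin d') Ψ s p q) :=
  {f | 0 < MeasureTheory.volume (parameterSet Ψ ν α γ N f.1)}

/-- Measurable for the completion of every `σ`-finite Borel measure. -/
def UniversallyMeasurable {X : Type*} [TopologicalSpace X] (A : Set X) : Prop :=
  letI : MeasurableSpace X := borel X
  ∀ μ : MeasureTheory.Measure X, MeasureTheory.SigmaFinite μ →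
    MeasureTheory.NullMeasurableSet A μ

end

open MeasureTheory Filter Topology Set

/-! Membership in the ancillary set depends only on the wavelet coefficients `c`, and these vary
continuously with the element of the Besov space. It is therefore enough to work in the Polish space
of all real families `c`; the Besov topology itself need not be Polish, for instance when `q = ∞`.
The condition on `(c, a, x)` is Borel. Eliminating `∃ x` projects a Borel set, which gives an
analytic set of pairs `(c, a)`; analytic sets are universally measurable (Lusin). By Fubini, the `c`
whose section has positive measure form a null measurable set
(`nullMeasurableSet_setOf_measure_exists_pos`), and pulling back along the coefficient map
concludes. -/

theorem polishSpace_pi_real (ι : Type*) [Countable ι] : PolishSpace (ι → ℝ) := inferInstance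

/-! ### Universal measurability of analytic sets. -/

section AnalyticSets

variable {X : Type*} [TopologicalSpace X]

/-- A neighbourhood of the image of the compact box `{x | ∀ i, x i ≤ n i}` of the Baire space contains
the image of a finite-dimensional box `{x | ∀ i < k, x i ≤ n i}`. -/
theorem exists_image_box_subset_of_isOpen {f : (ℕ → ℕ) → X} (hf : Continuous f) (n : ℕ → ℕ)
    {U : Set X} (hU : IsOpen U) (hnU : f '' {x | ∀ i, x i ≤ n i} ⊆ U) :
    ∃ k, f '' {x | ∀ i < k, x i ≤ n i} ⊆ U := by
  by_contra! h
  have h' : ∀ k, ∃ x : ℕ → ℕ, (∀ i < k, x i ≤ n i) ∧ f x ∉ U := by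
    intro k
    obtain ⟨_, ⟨x, hx, rfl⟩, hxU⟩ := Set.not_subset.1 (h k)
    exact ⟨x, hx, hxU⟩
  choose x hx hxU using h'
  have hK : IsCompact (Set.Iic n) := by
    rw [← Set.pi_univ_Iic]
    exact isCompact_univ_pi fun i => (Set.finite_Iic (n i)).isCompact
  -- Truncating by `n` moves `x k` into the compact box without changing its first `k` coordinates,
  -- so a limit of truncations is also a limit of the `x k` themselves.
  obtain ⟨y, hy, φ, hφ, hlim⟩ :=
    hK.tendsto_subseq (x := fun k => x k ⊓ n) fun k => (inf_le_right : x k ⊓ n ≤ n)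
  have hlim' : Tendsto (x ∘ φ) atTop (𝓝 y) := by
    rw [tendsto_pi_nhds] at hlim ⊢
    intro i
    refine (hlim i).congr' ?_
    filter_upwards [eventually_gt_atTop i] with k hk
    exact inf_of_le_left (hx (φ k) i (hk.trans_le (hφ.id_le k)))
  have hyU : f y ∈ Uᶜ := hU.isClosed_compl.mem_of_tendsto ((hf.tendsto y).comp hlim')
    (Eventually.of_forall fun k => hxU (φ k))
  exact hyU (hnU ⟨y, hy, rfl⟩)

variable [MeasurableSpace X]

/-- Inner approximation by compact sets of the range of a continuous function on the Baire space. -/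
theorem exists_isCompact_subset_range_le_measure [T2Space X] (μ : Measure X) [μ.OuterRegular]
    {f : (ℕ → ℕ) → X} (hf : Continuous f) {t : ENNReal} (ht : t < μ (range f)) :
    ∃ K ⊆ range f, IsCompact K ∧ t ≤ μ K := by
  -- Bounding one more coordinate keeps the measure above `t`: continuity from below holds for the
  -- outer measure, so the images need not be measurable.
  have step : ∀ (k : ℕ) (S : {S : Set (ℕ → ℕ) // t < μ (f '' S)}),
      ∃ m : ℕ, t < μ (f '' (S.1 ∩ {x | x k ≤ m})) := by
    rintro k ⟨S, hS⟩
    have hmono : Monotone fun m : ℕ => f '' (S ∩ {x | x k ≤ m}) := fun a b hab =>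
      image_mono (inter_subset_inter_right _ fun x (hx : x k ≤ a) => hx.trans hab)
    have hunion : f '' S = ⋃ m : ℕ, f '' (S ∩ {x | x k ≤ m}) := by
      rw [← image_iUnion, ← inter_iUnion]
      congr 1
      exact (inter_eq_left.2 fun x _ => mem_iUnion.2 ⟨x k, le_refl (x k)⟩).symm
    rw [hunion, hmono.measure_iUnion] at hS
    exact lt_iSup_iff.1 hS
  choose m hm using step
  let B : ℕ → {S : Set (ℕ → ℕ) // t < μ (f '' S)} := fun k =>
    Nat.rec ⟨univ, by rwa [image_univ]⟩ (fun k S => ⟨S.1 ∩ {x | x k ≤ m k S}, hm k S⟩) k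
  let n : ℕ → ℕ := fun k => m k (B k)
  have hB : ∀ k, (B k).1 = {x | ∀ i < k, x i ≤ n i} := by
    intro k
    induction k with
    | zero => ext x; simp [B]
    | succ k ih =>
      have : (B (k + 1)).1 = (B k).1 ∩ {x | x k ≤ n k} := rfl
      rw [this, ih]
      ext x
      simp only [mem_inter_iff, mem_ofPred_eq, Nat.forall_lt_succ_right]
  have hK : IsCompact (Set.Iic n) := by
    rw [← Set.pi_univ_Iic]
    exact isCompact_univ_pi fun i => (Set.finite_Iic (n i)).isCompact
  refine ⟨f '' Set.Iic n, image_subset_range _ _, hK.image hf, ?_⟩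
  -- Otherwise an open set of measure below `t` contains the compact image, hence the image of some
  -- `B k`, which has measure above `t`.
  by_contra! hlt
  obtain ⟨U, hU, hUo, hUt⟩ := Set.exists_isOpen_lt_of_lt _ _ hlt
  obtain ⟨k, hk⟩ := exists_image_box_subset_of_isOpen hf n hUo hU
  exact lt_irrefl t (((hB k ▸ (B k).2).trans_le (measure_mono hk)).trans hUt)

/-- Analytic sets are universally measurable. -/
theorem MeasureTheory.AnalyticSet.nullMeasurableSet [BorelSpace X] [PolishSpace X] {A : Set X}
    (hA : AnalyticSet A) (μ : Measure X) [SFinite μ] : NullMeasurableSet A μ := by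
  suffices h : ∀ ν : Measure X, IsFiniteMeasure ν → NullMeasurableSet A ν from
    (h μ.toFinite inferInstance).mono_ac (absolutelyContinuous_toFinite μ)
  intro ν _
  let := TopologicalSpace.upgradeIsCompletelyMetrizable X
  rw [AnalyticSet] at hA
  obtain rfl | ⟨f, hf, rfl⟩ := hA
  · exact MeasurableSet.empty.nullMeasurableSet
  obtain h0 | h0 := eq_or_ne (ν (range f)) 0
  · exact NullMeasurableSet.of_null h0
  obtain ⟨t, -, ht, htlim⟩ := exists_seq_strictMono_tendsto' (pos_iff_ne_zero.2 h0)
  choose K hKsub hKc hKt using fun i =>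
    exists_isCompact_subset_range_le_measure ν hf (ht i).2
  have hmeas : MeasurableSet (⋃ i, K i) := .iUnion fun i => (hKc i).measurableSet
  refine NullMeasurableSet.congr hmeas.nullMeasurableSet
    (ae_eq_of_subset_of_measure_ge (iUnion_subset hKsub) ?_ hmeas.nullMeasurableSet
      (measure_ne_top ν _))
  exact le_of_tendsto' htlim fun i => (hKt i).trans (measure_mono (subset_iUnion K i))

end AnalyticSets

/-! ### Sections of positive measure, and preimages. -/

/-- Replace `P` by an a.e. equal measurable set `M`: for almost every `x` the two sections agree
a.e., and section measures of `M` are measurable in `x`. -/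
theorem MeasureTheory.NullMeasurableSet.setOf_measure_section_pos {X Y : Type*} [MeasurableSpace X]
    [MeasurableSpace Y] {μ : Measure X} {ν : Measure Y} [SFinite ν] {P : Set (X × Y)}
    (hP : NullMeasurableSet P (μ.prod ν)) :
    NullMeasurableSet {x | 0 < ν (Prod.mk x ⁻¹' P)} μ := by
  obtain ⟨M, hM, hPM⟩ := hP
  have hmeas : MeasurableSet {x | 0 < ν (Prod.mk x ⁻¹' M)} :=
    measurableSet_lt measurable_const (measurable_measure_prodMk_left hM)
  refine hmeas.nullMeasurableSet.congr ?_
  filter_upwards [Measure.ae_ae_of_ae_prod hPM] with x hx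
  have hx' : Prod.mk x ⁻¹' P =ᵐ[ν] Prod.mk x ⁻¹' M := hx
  exact propext (by
    change 0 < ν (Prod.mk x ⁻¹' M) ↔ 0 < ν (Prod.mk x ⁻¹' P)
    rw [measure_congr hx'])

/-- For a Borel set `E` in a product of three Polish spaces, the set of those `x` for which the
projection to the second factor of the section `E_x` has positive measure is universally
measurable. -/
theorem nullMeasurableSet_setOf_measure_exists_pos {X Y Z : Type*}
    [TopologicalSpace X] [PolishSpace X] [MeasurableSpace X] [BorelSpace X]
    [TopologicalSpace Y] [PolishSpace Y] [MeasurableSpace Y] [BorelSpace Y]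
    [TopologicalSpace Z] [PolishSpace Z] [MeasurableSpace Z] [BorelSpace Z]
    {E : Set ((X × Y) × Z)} (hE : MeasurableSet E) (μ : Measure X) [SFinite μ]
    (ν : Measure Y) [SFinite ν] :
    NullMeasurableSet {x | 0 < ν {y | ∃ z, ((x, y), z) ∈ E}} μ := by
  have h : AnalyticSet (Prod.fst '' E) := hE.analyticSet.image_of_continuous continuous_fst
  convert (h.nullMeasurableSet (μ.prod ν)).setOf_measure_section_pos using 5
  ext y
  simp

theorem UniversallyMeasurable.preimage {X Y : Type*} [TopologicalSpace X] [TopologicalSpace Y]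
    {A : Set Y} (hA : UniversallyMeasurable A) {g : X → Y} (hg : Continuous g) :
    UniversallyMeasurable (g ⁻¹' A) := by
  let : MeasurableSpace X := borel X
  let : MeasurableSpace Y := borel Y
  have : BorelSpace X := ⟨rfl⟩
  have : BorelSpace Y := ⟨rfl⟩
  intro μ _
  -- A pushforward of a σ-finite measure can fail to be σ-finite, so `μ` is first replaced by a
  -- finite measure that dominates it.
  have h : NullMeasurableSet A (μ.toFinite.map g) := hA _ inferInstance
  exact (h.preimage ⟨hg.measurable, .rfl⟩).mono_ac (absolutelyContinuous_toFinite μ)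

/-- A convex function on a finite-dimensional space is continuous. -/
theorem Seminorm.continuous_of_fintype {ι : Type*} [Fintype ι] (ν : Seminorm ℝ (ι → ℝ)) :
    Continuous ν :=
  continuousOn_univ.1 (ν.convexOn.continuousOn isOpen_univ)

theorem measurableSet_dyadicApprox (d : ℕ) (α : ℝ) : MeasurableSet (dyadicApprox d α) := by
  have h : dyadicApprox d α = Icc 0 1 ∩ limsup (fun j : ℕ => ⋃ k : Fin d → Fin (2 ^ j),
      Metric.closedBall (fun i => ((k i : ℕ) : ℝ) / 2 ^ j) (2 ^ (-(α * j)))) atTop := by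
    ext x
    simp only [dyadicApprox, mem_ofPred_eq, mem_inter_iff, mem_limsup_iff_frequently_mem,
      mem_iUnion]
  rw [h]
  exact measurableSet_Icc.inter (.measurableSet_limsup fun j =>
    .iUnion fun k => Metric.isClosed_closedBall.measurableSet)

/-! ### Joint measurability of the series and of the trace coefficients. -/

section Measurability

variable {ι : Type} [Fintype ι] {Ψ : Fin 2 → ℝ → ℝ}

theorem continuous_tensorWavelet (hΨ : ∀ l, Continuous (Ψ l)) (lam : WaveletIndex ι) :
    Continuous (tensorWavelet Ψ lam) := by
  unfold tensorWavelet
  fun_prop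

/-- `tsum` is `0` where the series is not summable; with this convention the sum is measurable on
the whole space. -/
theorem measurable_waveletSeries [DecidableEq ι] (hΨ : ∀ l, Continuous (Ψ l)) :
    Measurable fun z : (WaveletIndex ι → ℝ) × (ι → ℝ) => waveletSeries Ψ z.1 z.2 := by
  unfold waveletSeries waveletBlock
  refine Measurable.tsum fun j => Finset.measurable_sum _ fun kl _ => ?_
  exact ((measurable_pi_apply _).comp measurable_fst).mul
    ((continuous_tensorWavelet hΨ _).measurable.comp measurable_snd)

theorem measurable_waveletCoeff_trace {d d' : ℕ} (hΨ : ∀ l, Continuous (Ψ l))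
    (lam : WaveletIndex (Fin d)) :
    Measurable fun z : (WaveletIndex (Fin d ⊕ Fin d') → ℝ) × (Fin d' → ℝ) =>
      waveletCoeff Ψ (trace (waveletSeries Ψ z.1) z.2) lam := by
  unfold waveletCoeff
  refine Measurable.const_mul ?_ _
  refine (StronglyMeasurable.integral_prod_right'
    (f := fun w : ((WaveletIndex (Fin d ⊕ Fin d') → ℝ) × (Fin d' → ℝ)) × (Fin d → ℝ) =>
      trace (waveletSeries Ψ w.1.1) w.1.2 w.2 * tensorWavelet Ψ lam w.2) ?_).measurable
  refine (Measurable.mul ?_ ?_).stronglyMeasurable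
  · unfold trace
    refine (measurable_waveletSeries hΨ).comp
      ((measurable_fst.comp measurable_fst).prodMk (measurable_pi_iff.2 ?_))
    rintro (i | i)
    · exact (measurable_pi_apply i).comp measurable_snd
    · exact (measurable_pi_apply i).comp (measurable_snd.comp measurable_fst)
  · exact (continuous_tensorWavelet hΨ lam).measurable.comp measurable_snd

end Measurability

/-! ### Continuity of the coefficients. -/

section BesovSpace

variable {ι : Type} [Fintype ι] [DecidableEq ι] {s p : ℝ} {q : ENNReal}

theorem ofReal_besovLevel_rpow_le_besovNorm (hq : 0 < q) (c : WaveletIndex ι → ℝ) (j : ℕ+) :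
    ENNReal.ofReal (besovLevel s p c j) ^ (1 / p) ≤ besovNorm s p q c := by
  unfold besovNorm
  split_ifs with hqt
  · exact le_iSup (fun j : ℕ+ => ENNReal.ofReal (besovLevel s p c j) ^ (1 / p)) j
  · have hq' : 0 < q.toReal := ENNReal.toReal_pos hq.ne' hqt
    calc ENNReal.ofReal (besovLevel s p c j) ^ (1 / p)
        = (ENNReal.ofReal (besovLevel s p c j) ^ (q.toReal / p)) ^ (1 / q.toReal) := by
          rw [← ENNReal.rpow_mul]
          congr 1
          field_simp
      _ ≤ _ := ENNReal.rpow_le_rpow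
          (ENNReal.le_tsum (f := fun j : ℕ+ =>
            ENNReal.ofReal (besovLevel s p c j) ^ (q.toReal / p)) j) (by positivity)

/-- The (quasi-)norm controls each wavelet coefficient. -/
theorem ofReal_mul_abs_le_besovNorm (hp : 0 < p) (hq : 0 < q) (c : WaveletIndex ι → ℝ)
    (lam : WaveletIndex ι) :
    ENNReal.ofReal ((2 ^ ((s * p - Fintype.card ι) * ((lam.1 : ℕ) : ℝ))) ^ (1 / p) * |c lam|) ≤
      besovNorm s p q c := by
  refine le_trans ?_ (ofReal_besovLevel_rpow_le_besovNorm hq c lam.1)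
  have h0 : (0 : ℝ) < 2 ^ ((s * p - Fintype.card ι) * ((lam.1 : ℕ) : ℝ)) := by positivity
  have hle : 2 ^ ((s * p - Fintype.card ι) * ((lam.1 : ℕ) : ℝ)) * |c lam| ^ p ≤
      besovLevel s p c lam.1 :=
    mul_le_mul_of_nonneg_left (Finset.single_le_sum (f := fun kl => |c ⟨lam.1, kl⟩| ^ p)
      (fun _ _ => by positivity) (Finset.mem_univ lam.2)) h0.le
  rw [ENNReal.ofReal_rpow_of_nonneg (le_trans (by positivity) hle) (by positivity)]
  refine ENNReal.ofReal_le_ofReal (le_trans (le_of_eq ?_)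
    (Real.rpow_le_rpow (by positivity) hle (by positivity)))
  rw [Real.mul_rpow h0.le (by positivity), one_div, Real.rpow_rpow_inv (abs_nonneg _) hp.ne']

theorem BesovSpace.continuous_coe (hp : 0 < p) (hq : 0 < q) :
    Continuous fun c : BesovSpace ι s p q => c.1 := by
  refine continuous_pi fun lam => continuous_def.2 fun V hV => ?_
  -- This is openness by definition; the radius `C * δ` below works because `C * |c lam|` is at most
  -- the quasi-norm.
  change ∀ c : BesovSpace ι s p q, c.1 lam ∈ V → ∃ ε : ENNReal, 0 < ε ∧
    ∀ c' : BesovSpace ι s p q, besovNorm s p q (c'.1 - c.1) < ε → c'.1 lam ∈ V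
  intro c hc
  obtain ⟨δ, hδ, hV⟩ := Metric.isOpen_iff.1 hV _ hc
  set C : ℝ := (2 ^ ((s * p - Fintype.card ι) * ((lam.1 : ℕ) : ℝ))) ^ (1 / p) with hC
  have hC0 : 0 < C := by positivity
  refine ⟨ENNReal.ofReal (C * δ), ENNReal.ofReal_pos.2 (by positivity), fun c' hc' => hV ?_⟩
  have h := (ofReal_mul_abs_le_besovNorm hp hq (c'.1 - c.1) lam).trans_lt hc'
  rw [← hC, ENNReal.ofReal_lt_ofReal_iff (by positivity)] at h
  exact lt_of_mul_lt_mul_left h hC0.le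

end BesovSpace

theorem BesovFunction.waveletSeries_waveletCoeff {ι : Type} [Fintype ι] [DecidableEq ι]
    {Ψ : Fin 2 → ℝ → ℝ} {s p : ℝ} {q : ENNReal} (f : BesovFunction (ι := ι) Ψ s p q) :
    waveletSeries Ψ (waveletCoeff Ψ f.1) = f.1 :=
  funext fun x => (f.2.2 x).tsum_eq

theorem BesovFunction.continuous_waveletCoeff {ι : Type} [Fintype ι] [DecidableEq ι]
    {Ψ : Fin 2 → ℝ → ℝ} {s p : ℝ} {q : ENNReal} :
    Continuous fun f : BesovFunction (ι := ι) Ψ s p q => waveletCoeff Ψ f.1 :=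
  continuous_subtype_val.comp
    (continuous_induced_dom (f := fun f : BesovFunction (ι := ι) Ψ s p q =>
      (⟨waveletCoeff Ψ f.1, f.2.1⟩ : {c : WaveletIndex ι → ℝ // besovNorm s p q c < ⊤})))

/-- The set of all families `c` whose parameter set has positive measure is universally measurable
for the product topology. -/
theorem universallyMeasurable_setOf_volume_parameterSet_pos {d d' : ℕ} {Ψ : Fin 2 → ℝ → ℝ}
    (hΨ : ∀ l, Continuous (Ψ l)) (ν : Seminorm ℝ (Fin d → ℝ)) (α γ : ℝ) (N : ℕ) :
    UniversallyMeasurable {c : WaveletIndex (Fin d ⊕ Fin d') → ℝ |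
      0 < volume (parameterSet Ψ ν α γ N (waveletSeries Ψ c))} := by
  unfold UniversallyMeasurable
  -- The index set is countable, so the Borel and product σ-algebras coincide.
  rw [← BorelSpace.measurable_eq (α := WaveletIndex (Fin d ⊕ Fin d') → ℝ)]
  intro μ _
  have : PolishSpace (WaveletIndex (Fin d ⊕ Fin d') → ℝ) :=
    polishSpace_pi_real _
  let E : Set (((WaveletIndex (Fin d ⊕ Fin d') → ℝ) × (Fin d' → ℝ)) × (Fin d → ℝ)) :=
    {w | w.1.2 ∈ Icc 0 1 ∧ w.2 ∈ dyadicApprox d α ∧ ∀ lam : WaveletIndex (Fin d),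
      |waveletCoeff Ψ (trace (waveletSeries Ψ w.1.1) w.1.2) lam| ≤
        N * 2 ^ (-(γ * ((lam.1 : ℕ) : ℝ))) *
          (1 + ν (fun i => 2 ^ (lam.1 : ℕ) * w.2 i - ((lam.2.1 i : ℕ) : ℝ))) ^ γ}
  have hE : MeasurableSet E := by
    simp only [E, ofPred_and, ofPred_forall]
    refine ((measurable_snd.comp measurable_fst) measurableSet_Icc).inter
      ((measurable_snd (measurableSet_dyadicApprox d α)).inter ?_)
    refine MeasurableSet.iInter fun lam => measurableSet_le ?_ ?_
    · exact ((measurable_waveletCoeff_trace hΨ lam).comp measurable_fst).abs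
    · have hν : Continuous ν := ν.continuous_of_fintype
      have h : Continuous fun w : ((WaveletIndex (Fin d ⊕ Fin d') → ℝ) × (Fin d' → ℝ)) ×
          (Fin d → ℝ) =>
          1 + ν (fun i => 2 ^ (lam.1 : ℕ) * w.2 i - ((lam.2.1 i : ℕ) : ℝ)) := by fun_prop
      exact (h.measurable.pow_const γ).const_mul _
  convert nullMeasurableSet_setOf_measure_exists_pos hE μ (volume : Measure (Fin d' → ℝ)) using 5
  ext a
  simp [E, parameterSet]

/-- The set `𝒪_{γ,N}` of functions is universally measurable for every topology that makes the wavelet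
coefficients continuous, in particular for the topology of the (quasi-)norm and for the coarser
topology of coordinatewise convergence of the coefficients. -/
theorem universallyMeasurable_ancillaryFunctionSet {d d' : ℕ} {Ψ : Fin 2 → ℝ → ℝ} {s p : ℝ}
    {q : ENNReal} (hΨ : ∀ l, Continuous (Ψ l)) (ν : Seminorm ℝ (Fin d → ℝ)) (α γ : ℝ) (N : ℕ)
    {t : TopologicalSpace (BesovFunction (ι := Fin d ⊕ Fin d') Ψ s p q)}
    (ht : Continuous[t, Pi.topologicalSpace] fun f : BesovFunction (ι := Fin d ⊕ Fin d') Ψ s p q =>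
      waveletCoeff Ψ f.1) :
    @UniversallyMeasurable _ t (ancillaryFunctionSet (d := d) (d' := d') Ψ ν s p q α γ N) := by
  convert (universallyMeasurable_setOf_volume_parameterSet_pos hΨ ν α γ N).preimage ht using 1
  ext f
  simp only [ancillaryFunctionSet, mem_preimage, mem_ofPred_eq, f.waveletSeries_waveletCoeff]

theorem mainTheorem9 (d d' : ℕ) (hd : 1 ≤ d) (hd' : 1 ≤ d')
    (s p : ℝ) (q : ENNReal) (hp : 0 < p) (hq : 0 < q) (hs : (d : ℝ) / p < s)
    (R : ℕ) (hR : ⌊s + 1⌋₊ ≤ R) (Ψ : Fin 2 → ℝ → ℝ) (hΨ : IsRegularWavelet R Ψ)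
    (ν : Seminorm ℝ (Fin d → ℝ)) (hν : ∀ x, ν x = 0 → x = 0)
    (α γ : ℝ) (hα : 1 < α) (hγ : s - d / p + d / (α * p) < γ) (N : ℕ) :
    UniversallyMeasurable (ancillarySet (d := d) (d' := d') Ψ ν s p q α γ N) ∧
      (((d + d' : ℕ) : ℝ) / p < s →
        UniversallyMeasurable (ancillaryFunctionSet (d := d) (d' := d') Ψ ν s p q α γ N)) := by
  have hc : ∀ l, Continuous (Ψ l) := fun l => (hΨ.contDiff l).continuous
  exact ⟨(universallyMeasurable_setOf_volume_parameterSet_pos hc ν α γ N).preimage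
    (BesovSpace.continuous_coe hp hq), fun _ => universallyMeasurable_ancillaryFunctionSet hc ν α γ N
      BesovFunction.continuous_waveletCoeff⟩
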